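/- Let $\mathbf G$ be the graph on $\mathbb Z^2$ in which each point $p$ is joined to $p\pm(1,0)$, $p\pm(0,1)$, $p\pm(1,-1)$; connectedness and paths are understood in $\mathbf G$. For $p\in\mathbb Z^2$ let $Q(p)=\{p,\,p+(1,0),\,p+(0,1)\}$ (a tile), and for $S\subseteq\mathbb Z^2$ put $$R(S)=\{p : |Q(p)\cap S|\ge 2\},\qquad Q(S)=\bigcup_{a\in S}Q(a),\qquad R^+(S)=Q(R(R(S))).$$ For reals $a,b,c$ with $a+b+c\ge 0$ the triangle $L(a,b,c)$ is $\{(x,y): -x\le a,\ -y\le b,\ x+y\le c\}$, and its span is $a+b+c$. For $E\subseteq\mathbb Z^2$ let $\mathrm{Span}(E)$ be the least value of $\sum_i(a_i+b_i+c_i)$ over all finite families of triangles $L(a_i,b_i,c_i)$ whose deflations by $2$ cover $E$, that is, $E\subseteq\bigcup_i L(a_i-2,b_i-2,c_i-2)$; it is $\infty$ if there is no such family. A cut of a set $S\subseteq\mathbb Z^2$ is a triple $(C,A_1,A_2)$ of disjoint subsets of $S$, with $C$ finite, such that every path in $S$ from $A_1$ to $A_2$ passes through an element of $C$. The thickness $\Theta(S,6)$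 is the smallest $k$ such that $S$ has a cut $(C,A_1,A_2)$ with $|C|=k$ and $\min_{j=1,2}\mathrm{Span}(A_j\cup C)>6k$; if there is no such $k$, then $\Theta(S,6)=\infty$. **Theorem.** For every connected (finite or infinite) set $S\subseteq\mathbb Z^2$, $$\Theta(R^+(S),6)\ \ge\ \Theta(S,6)+1 .$$ -/

import Mathlib

/-- The graph `G` on the lattice `ℤ × ℤ`: every site is joined to its northern, southern, eastern,
western, north-western and south-eastern neighbours. -/
def toomGraph : SimpleGraph (ℤ × ℤ) where
  Adj p q := q - p ∈
    ({(0, 1), (0, -1), (1, 0), (-1, 0), (-1, 1), (1, -1)} : Set (ℤ × ℤ))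
  symm := ⟨by
    rintro ⟨a, b⟩ ⟨c, d⟩ h
    simp only [Prod.mk_sub_mk, Set.mem_insert_iff, Set.mem_singleton_iff, Prod.mk.injEq] at h ⊢
    omega⟩
  loopless := ⟨by
    rintro ⟨a, b⟩ h
    simp only [Prod.mk_sub_mk, Set.mem_insert_iff, Set.mem_singleton_iff, Prod.mk.injEq] at h
    omega⟩

/-- A set of sites is connected in the graph `G` (the empty set is allowed). -/
def IsConn (S : Set (ℤ × ℤ)) : Prop := (toomGraph.induce S).Preconnected

/-- The tile `Q(p)`: the point `p` with its eastern and northern neighbours. -/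
def tile (p : ℤ × ℤ) : Set (ℤ × ℤ) := {p, p + (1, 0), p + (0, 1)}

/-- Toom's rule `R`: `p ∈ R(S)` iff `S` contains at least two of the three points of `Q(p)`. -/
def toom (S : Set (ℤ × ℤ)) : Set (ℤ × ℤ) := {p | 2 ≤ (tile p ∩ S).ncard}

/-- Inflation `Q(E)`: the union of the tiles `Q(a)` for `a ∈ E`. -/
def inflate (E : Set (ℤ × ℤ)) : Set (ℤ × ℤ) := ⋃ a ∈ E, tile a

/-- The biased Toom rule `R⁺ = Q ∘ R²`. -/
def biasedToom (S : Set (ℤ × ℤ)) : Set (ℤ × ℤ) := inflate (toom (toom S))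

/-- The real parameters `(a, b, c)` of a triangle `L(a, b, c)`. -/
structure Triangle where
  a : ℝ
  b : ℝ
  c : ℝ

/-- The lattice points of `L(a, b, c)`, cut out by `-x ≤ a`, `-y ≤ b`, `x + y ≤ c`. -/
def Triangle.points (I : Triangle) : Set (ℤ × ℤ) :=
  {p | -(p.1 : ℝ) ≤ I.a ∧ -(p.2 : ℝ) ≤ I.b ∧ (p.1 : ℝ) + (p.2 : ℝ) ≤ I.c}

/-- The deflation `D(I, d) = L(a - d, b - d, c - d)`. -/
def Triangle.deflate (I : Triangle) (d : ℝ) : Triangle := ⟨I.a - d, I.b - d, I.c - d⟩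

/-- The span `a + b + c` of the triangle `L(a, b, c)`. -/
def Triangle.span (I : Triangle) : ℝ := I.a + I.b + I.c

/-- A finite set of (genuine, that is, of nonnegative span) triangles covers `E` with its
`d`-deflation. -/
def CoversWithDeflation (𝓘 : Finset Triangle) (d : ℝ) (E : Set (ℤ × ℤ)) : Prop :=
  (∀ I ∈ 𝓘, 0 ≤ I.span) ∧ E ⊆ ⋃ I ∈ 𝓘, (I.deflate d).points

/-- `span(E, d)`: the least total span of a finite set of triangles covering `E` with its
`d`-deflation; it is `⊤` if there is none. -/
noncomputable def coverSpan (E : Set (ℤ × ℤ)) (d : ℝ) : EReal :=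
  ⨅ (𝓘 : Finset Triangle) (_ : CoversWithDeflation 𝓘 d E), ((∑ I ∈ 𝓘, I.span : ℝ) : EReal)

/-- `Span(E) = span(E, 2)`. -/
noncomputable def bigSpan (E : Set (ℤ × ℤ)) : EReal := coverSpan E 2

/-- `(C, A₁, A₂)` is a cut of `S`: `C`, `A₁`, `A₂` are disjoint subsets of `S`, and every path
in `S` from `A₁` to `A₂` passes through an element of `C`. -/
structure IsCut (S : Set (ℤ × ℤ)) (C : Finset (ℤ × ℤ)) (A₁ A₂ : Set (ℤ × ℤ)) : Prop where
  subset_C : (C : Set (ℤ × ℤ)) ⊆ S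
  subset_left : A₁ ⊆ S
  subset_right : A₂ ⊆ S
  disjoint_C_left : Disjoint (C : Set (ℤ × ℤ)) A₁
  disjoint_C_right : Disjoint (C : Set (ℤ × ℤ)) A₂
  disjoint_left_right : Disjoint A₁ A₂
  separates : ∀ a ∈ A₁, ∀ b ∈ A₂, ∀ w : toomGraph.Walk a b, (∀ v ∈ w.support, v ∈ S) →
    ∃ v ∈ w.support, v ∈ C

/-- The `α`-thickness of `S`: the least `k` for which `S` has a cut `(C, A₁, A₂)` with `|C| = k`
and `min (Span (A₁ ∪ C)) (Span (A₂ ∪ C)) > α k`; it is `⊤` if there is no such `k`. -/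
noncomputable def thickness (S : Set (ℤ × ℤ)) (α : ℝ) : ℕ∞ :=
  sInf {k : ℕ∞ | ∃ (C : Finset (ℤ × ℤ)) (A₁ A₂ : Set (ℤ × ℤ)), IsCut S C A₁ A₂ ∧
    k = (C.card : ℕ∞) ∧
    ((α * (C.card : ℝ) : ℝ) : EReal) < min (bigSpan (A₁ ∪ ↑C)) (bigSpan (A₂ ∪ ↑C))}

/-! ### Tiles and adjacency -/

/-! Take a wide split `(C, A, B)` of `biasedToom S` with the fewest cut points. Minimality makes `A
∪ C` and `B ∪ C` connected (`IsSplit.indecomposable_left`). Put `U = toom (toom S)`.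

If every tile meeting `C` has its base in `U`, then all lattice neighbours of `C` lie in the set,
and planarity makes `C` enclose one of the two sides. A side so enclosed has span at most `6 |C|`, a
contradiction (`IsSplit.bigSpan_le_of_surrounded`).

Otherwise some `p ∈ C` lies in a tile with base `r ∉ U`. Translating the split by `r - p` and
restricting it to `U` loses a nonempty set `F` of cut points (`IsSplit.exists_shift`). Each of the
two applications of Toom's rule is then undone without enlarging the cut (`IsSplit.exists_lift`),
which gives a split of `S` with cut `C₃`, where `|C₃| + |F| ≤ |C|`.

The new split is still wide. A cover of a new side by triangles deflated by 2 absorbs the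
displacements of the three pullbacks, and one tile for each point of `F` completes it to a cover of
the old side. As the old side is connected, these triangles merge into one without increasing the
total span (`exists_triangle_of_indecomposable`), and re-inflating that one costs 5. An old span
above `6 |C|` thus excludes a new span of at most `6 |C₃|`, because `6 |C₃| + |F| + 5 ≤ 6 |C|`. -/

theorem toomGraph_adj_iff (a b c d : ℤ) : toomGraph.Adj (a, b) (c, d) ↔
    (c = a ∧ d = b + 1) ∨ (c = a ∧ d = b - 1) ∨ (c = a + 1 ∧ d = b) ∨ (c = a - 1 ∧ d = b) ∨
      (c = a - 1 ∧ d = b + 1) ∨ (c = a + 1 ∧ d = b - 1) := by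
  simp only [toomGraph, Prod.mk_sub_mk, Set.mem_insert_iff, Set.mem_singleton_iff, Prod.mk.injEq]
  omega

theorem mem_tile_iff (a b c d : ℤ) : (c, d) ∈ tile (a, b) ↔
    (c = a ∧ d = b) ∨ (c = a + 1 ∧ d = b) ∨ (c = a ∧ d = b + 1) := by
  simp only [tile, Prod.mk_add_mk, Set.mem_insert_iff, Set.mem_singleton_iff, Prod.mk.injEq]
  omega

theorem self_mem_tile (p : ℤ × ℤ) : p ∈ tile p := by simp [tile]

theorem adj_of_mem_tile {p q r : ℤ × ℤ} (hq : q ∈ tile p) (hr : r ∈ tile p) (hne : q ≠ r) :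
    toomGraph.Adj q r := by
  obtain ⟨a, b⟩ := p; obtain ⟨c, d⟩ := q; obtain ⟨e, f⟩ := r
  rw [mem_tile_iff] at hq hr
  rw [toomGraph_adj_iff]
  simp only [ne_eq, Prod.mk.injEq] at hne
  omega

theorem adj_of_tiles_meet {p q r : ℤ × ℤ} (hp : r ∈ tile p) (hq : r ∈ tile q) (hne : p ≠ q) :
    toomGraph.Adj p q := by
  obtain ⟨a, b⟩ := p; obtain ⟨c, d⟩ := q; obtain ⟨e, f⟩ := r
  rw [mem_tile_iff] at hp hq
  rw [toomGraph_adj_iff]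
  simp only [ne_eq, Prod.mk.injEq] at hne
  omega

/-- The coordinatewise maximum is such a point. This makes tiles of neighbouring sites overlap, so
that triangles containing them can be merged. -/
theorem exists_mem_tiles_of_adj {p q : ℤ × ℤ} (h : toomGraph.Adj p q) :
    ∃ r, r ∈ tile p ∧ r ∈ tile q := by
  obtain ⟨a, b⟩ := p; obtain ⟨c, d⟩ := q
  rw [toomGraph_adj_iff] at h
  refine ⟨(max a c, max b d), ?_⟩
  rw [mem_tile_iff, mem_tile_iff]
  omega

theorem exists_tile_of_adj {p q : ℤ × ℤ} (h : toomGraph.Adj p q) :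
    ∃ r, p ∈ tile r ∧ q ∈ tile r := by
  obtain ⟨a, b⟩ := p; obtain ⟨c, d⟩ := q
  rw [toomGraph_adj_iff] at h
  refine ⟨(min a c, min b d), ?_⟩
  rw [mem_tile_iff, mem_tile_iff]
  omega

theorem adj_add_right_iff {p q : ℤ × ℤ} (v : ℤ × ℤ) :
    toomGraph.Adj (p + v) (q + v) ↔ toomGraph.Adj p q := by
  simp [toomGraph]

theorem mem_toom_iff {W : Set (ℤ × ℤ)} {p : ℤ × ℤ} : p ∈ toom W ↔
    ∃ q ∈ tile p, ∃ r ∈ tile p, q ∈ W ∧ r ∈ W ∧ q ≠ r := by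
  have hfin : (tile p ∩ W).Finite := Set.Finite.inter_of_left (by simp [tile]) _
  change 1 < (tile p ∩ W).ncard ↔ _
  rw [Set.one_lt_ncard_iff hfin]
  constructor
  · rintro ⟨q, r, hq, hr, hne⟩
    exact ⟨q, hq.1, r, hr.1, hq.2, hr.2, hne⟩
  · rintro ⟨q, hq, r, hr, hqW, hrW, hne⟩
    exact ⟨q, r, ⟨hq, hqW⟩, ⟨hr, hrW⟩, hne⟩

theorem mem_inflate_iff {U : Set (ℤ × ℤ)} {p : ℤ × ℤ} :
    p ∈ inflate U ↔ ∃ u ∈ U, p ∈ tile u := by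
  simp [inflate]

/-! ### Connectedness -/

/-- `S` has no proper nonempty subset that is closed under taking neighbours in `S`. -/
def Indecomposable (S : Set (ℤ × ℤ)) : Prop :=
  ∀ X ⊆ S, X.Nonempty → (∀ p ∈ X, ∀ q ∈ S, toomGraph.Adj p q → q ∈ X) → S ⊆ X

theorem IsConn.indecomposable {S : Set (ℤ × ℤ)} (hS : IsConn S) : Indecomposable S := by
  rintro X hXS ⟨p, hp⟩ hX q hq
  obtain ⟨w⟩ := hS ⟨p, hXS hp⟩ ⟨q, hq⟩
  have key : ∀ (a b : S), (toomGraph.induce S).Walk a b → a.1 ∈ X → b.1 ∈ X := by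
    intro a b w
    induction w with
    | nil => exact id
    | cons h _ ih => exact fun ha => ih (hX _ ha _ (Subtype.property _) h)
  exact key _ _ w hp

/-- Adjacent points of `W` share a tile, whose base is then in `toom W`; conversely, bases whose
tiles share a point are equal or adjacent. A closed part `X` of `toom W` therefore yields a closed
part of `W`, namely the points in the tiles of `X`. -/
theorem Indecomposable.toom {W : Set (ℤ × ℤ)} (hW : Indecomposable W) :
    Indecomposable (toom W) := by
  rintro X hX ⟨p₀, hp₀⟩ hcl
  have same : ∀ v p q, v ∈ tile p → v ∈ tile q → p ∈ X → q ∈ _root_.toom W → q ∈ X := by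
    intro v p q hp hq hpX hqW
    by_cases hne : p = q
    · exact hne ▸ hpX
    · exact hcl p hpX q hqW (adj_of_tiles_meet hp hq hne)
  have hY : W ⊆ {v | v ∈ W ∧ ∃ p ∈ X, v ∈ tile p} := by
    apply hW
    · exact fun v hv => hv.1
    · obtain ⟨q, hq, -, -, hqW, -⟩ := mem_toom_iff.1 (hX hp₀)
      exact ⟨q, hqW, p₀, hp₀, hq⟩
    · rintro v ⟨hv, p, hp, hvp⟩ w hw hvw
      obtain ⟨r, hr, hr'⟩ := exists_tile_of_adj hvw
      exact ⟨hw, r, same v p r hvp hr hp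
        (mem_toom_iff.2 ⟨v, hr, w, hr', hv, hw, hvw.ne⟩), hr'⟩
  intro q hq
  obtain ⟨v, hv, -, -, hvW, -⟩ := mem_toom_iff.1 hq
  obtain ⟨-, p, hp, hvp⟩ := hY hvW
  exact same v p q hvp hv hp hq

theorem Indecomposable.inflate {U : Set (ℤ × ℤ)} (hU : Indecomposable U) :
    Indecomposable (inflate U) := by
  rintro X hX ⟨x, hx⟩ hcl
  have near : ∀ u q, u ∈ U → q ∈ tile u → (q ∈ X ↔ u ∈ X) := by
    intro u q hu hq
    by_cases hne : q = u
    · rw [hne]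
    · have hadj := adj_of_mem_tile hq (self_mem_tile u) hne
      exact ⟨fun h => hcl _ h _ (mem_inflate_iff.2 ⟨u, hu, self_mem_tile u⟩) hadj,
        fun h => hcl _ h _ (mem_inflate_iff.2 ⟨u, hu, hq⟩) hadj.symm⟩
  have hY : U ⊆ U ∩ X := by
    apply hU _ Set.inter_subset_left
    · obtain ⟨u, hu, hxu⟩ := mem_inflate_iff.1 (hX hx)
      exact ⟨u, hu, (near u x hu hxu).1 hx⟩
    · rintro p ⟨hp, hpX⟩ q hq hpq
      exact ⟨hq, hcl p hpX q (mem_inflate_iff.2 ⟨q, hq, self_mem_tile q⟩) hpq⟩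
  intro q hq
  obtain ⟨u, hu, hqu⟩ := mem_inflate_iff.1 hq
  exact (near u q hu hqu).2 (hY hu).2

theorem Indecomposable.eqOn_const {E : Set (ℤ × ℤ)} (hE : Indecomposable E) {f : ℤ × ℤ → ℤ}
    (hf : ∀ p ∈ E, ∀ q ∈ E, toomGraph.Adj p q → f p = f q) {p q : ℤ × ℤ} (hp : p ∈ E)
    (hq : q ∈ E) : f p = f q := by
  have h := hE {x | x ∈ E ∧ f p = f x} (fun x hx => hx.1) ⟨p, hp, rfl⟩
    (fun x hx y hy hxy => ⟨hy, hx.2.trans (hf x hx.1 y hy hxy)⟩)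
  exact (h hq).2

/-- A finite set splits into pairwise non-adjacent connected pieces. -/
theorem exists_indecomposable_parts (C : Finset (ℤ × ℤ)) :
    ∃ P : Finpartition C, ∀ K ∈ P.parts, Indecomposable (K : Set (ℤ × ℤ)) ∧
      ∀ p ∈ K, ∀ q ∈ C, toomGraph.Adj p q → q ∈ K := by
  classical
  let r : ℤ × ℤ → ℤ × ℤ → Prop := fun a b => toomGraph.Adj a b ∧ a ∈ C ∧ b ∈ C
  let R : Setoid (ℤ × ℤ) := ⟨Relation.EqvGen r, Relation.EqvGen.is_equivalence r⟩
  let comp : ℤ × ℤ → Finset (ℤ × ℤ) := fun p => C.filter (Relation.EqvGen r p)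
  have hmem : ∀ p q, q ∈ comp p ↔ q ∈ C ∧ Relation.EqvGen r p q := fun p q => Finset.mem_filter
  have hcl : ∀ x, ∀ p ∈ comp x, ∀ q ∈ C, toomGraph.Adj p q → q ∈ comp x := by
    intro x p hp q hq hpq
    rw [hmem] at hp ⊢
    exact ⟨hq, hp.2.trans _ _ _ (.rel _ _ ⟨hpq, hp.1, hq⟩)⟩
  refine ⟨Finpartition.ofExistsUnique (C.image comp) ?_ ?_ ?_, ?_⟩
  · intro K hK
    obtain ⟨x, -, rfl⟩ := Finset.mem_image.1 hK
    exact Finset.filter_subset _ _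
  · intro a ha
    refine ⟨comp a, ⟨Finset.mem_image_of_mem _ ha, (hmem _ _).2 ⟨ha, .refl a⟩⟩, ?_⟩
    rintro K ⟨hK, haK⟩
    obtain ⟨x, -, rfl⟩ := Finset.mem_image.1 hK
    have hxa := ((hmem _ _).1 haK).2
    ext y
    rw [hmem, hmem]
    exact and_congr_right fun _ => ⟨fun h => hxa.symm.trans _ _ _ h, fun h => hxa.trans _ _ _ h⟩
  · intro h
    obtain ⟨x, hx, hx'⟩ := Finset.mem_image.1 h
    have : x ∈ comp x := (hmem _ _).2 ⟨hx, .refl x⟩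
    rw [hx'] at this
    exact absurd this (Finset.notMem_empty x)
  · intro K hK
    obtain ⟨x, hx, rfl⟩ := Finset.mem_image.1 hK
    refine ⟨?_, hcl x⟩
    rintro X hX ⟨y, hy⟩ hXcl
    have hiff : ∀ a b, Relation.EqvGen r a b → (a ∈ X ↔ b ∈ X) := by
      intro a b hab
      induction hab with
      | rel a b h =>
        exact ⟨fun ha => hXcl a ha b (hcl x a (hX ha) b h.2.2 h.1) h.1,
          fun hb => hXcl b hb a (hcl x b (hX hb) a h.2.1 h.1.symm) h.1.symm⟩
      | refl => exact Iff.rfl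
      | symm _ _ _ ih => exact ih.symm
      | trans _ _ _ _ _ ih ih' => exact ih.trans ih'
    intro z hz
    have hy' := ((hmem _ _).1 (hX hy)).2
    have hz' := ((hmem _ _).1 hz).2
    exact (hiff _ _ hz').1 ((hiff _ _ hy').2 hy)

/-! ### Triangles and spans -/

theorem Triangle.mem_points_iff (I : Triangle) (x y : ℤ) : (x, y) ∈ I.points ↔
    -(x : ℝ) ≤ I.a ∧ -(y : ℝ) ≤ I.b ∧ (x : ℝ) + y ≤ I.c := Iff.rfl

theorem Triangle.span_nonneg_of_mem {I : Triangle} {p : ℤ × ℤ} (hp : p ∈ I.points) :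
    0 ≤ I.span := by
  obtain ⟨h1, h2, h3⟩ := hp
  unfold Triangle.span
  linarith

/-- The least triangle that contains two given ones. -/
noncomputable def Triangle.join (I J : Triangle) : Triangle :=
  ⟨max I.a J.a, max I.b J.b, max I.c J.c⟩

theorem Triangle.points_subset_join_left (I J : Triangle) : I.points ⊆ (I.join J).points :=
  fun _ h => ⟨h.1.trans (le_max_left _ _), h.2.1.trans (le_max_left _ _),
    h.2.2.trans (le_max_left _ _)⟩

theorem Triangle.points_subset_join_right (I J : Triangle) : J.points ⊆ (I.join J).points :=
  fun _ h => ⟨h.1.trans (le_max_right _ _), h.2.1.trans (le_max_right _ _),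
    h.2.2.trans (le_max_right _ _)⟩

/-- The spans of the coordinatewise maximum and minimum add up to `I.span + J.span`, and the minimum
has nonnegative span because it contains the common point. -/
theorem Triangle.span_join_le {I J : Triangle} {p : ℤ × ℤ} (hI : p ∈ I.points)
    (hJ : p ∈ J.points) : (I.join J).span ≤ I.span + J.span := by
  obtain ⟨h1, h2, h3⟩ := hI
  obtain ⟨k1, k2, k3⟩ := hJ
  have e1 := max_add_min I.a J.a
  have e2 := max_add_min I.b J.b
  have e3 := max_add_min I.c J.c
  have m1 := le_min h1 k1
  have m2 := le_min h2 k2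
  have m3 := le_min h3 k3
  simp only [Triangle.join, Triangle.span]
  linarith

/-- A connected set whose tiles are each contained in one triangle of a family has all its tiles in
a single triangle, of no larger span. -/
theorem exists_triangle_of_indecomposable {E : Set (ℤ × ℤ)} (hE : Indecomposable E)
    (hne : E.Nonempty) (s : Multiset Triangle) (hs : ∀ I ∈ s, 0 ≤ I.span)
    (hcov : ∀ p ∈ E, ∃ I ∈ s, tile p ⊆ I.points) :
    ∃ J : Triangle, J.span ≤ (s.map Triangle.span).sum ∧ ∀ p ∈ E, tile p ⊆ J.points := by
  -- If the triangle `I` does not hold all the tiles, some edge of `E` leaves it. The triangle `J`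
  -- at the far end meets `I`, and replacing both by their join shrinks the family. A multiset keeps
  -- the sum exact even when the join is already a member.
  induction hn : s.card using Nat.strong_induction_on generalizing s with
  | _ n ih =>
  obtain ⟨p₀, hp₀⟩ := hne
  obtain ⟨I, hI, hp₀I⟩ := hcov p₀ hp₀
  have sum_nonneg : ∀ t : Multiset Triangle, (∀ I ∈ t, 0 ≤ I.span) →
      0 ≤ (t.map Triangle.span).sum := by
    intro t ht
    apply Multiset.sum_nonneg
    intro x hx
    obtain ⟨I, hI, rfl⟩ := Multiset.mem_map.1 hx
    exact ht I hI
  by_cases hall : ∀ p ∈ E, tile p ⊆ I.points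
  · refine ⟨I, ?_, hall⟩
    obtain ⟨t, rfl⟩ := Multiset.exists_cons_of_mem hI
    rw [Multiset.map_cons, Multiset.sum_cons]
    have := sum_nonneg t fun K hK => hs K (Multiset.mem_cons_of_mem hK)
    linarith
  · have hedge : ∃ p ∈ E, tile p ⊆ I.points ∧ ∃ q ∈ E, toomGraph.Adj p q ∧
        ¬ tile q ⊆ I.points := by
      by_contra hcon
      push Not at hcon
      refine hall fun p hp => (hE {p | p ∈ E ∧ tile p ⊆ I.points} (fun p hp => hp.1)
        ⟨p₀, hp₀, hp₀I⟩ ?_ hp).2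
      exact fun p hp q hq hpq => ⟨hq, hcon p hp.1 hp.2 q hq hpq⟩
    obtain ⟨p, hp, hpI, q, hq, hpq, hqI⟩ := hedge
    obtain ⟨J, hJ, hqJ⟩ := hcov q hq
    have hJI : J ≠ I := fun h => hqI (h ▸ hqJ)
    obtain ⟨t, rfl⟩ := Multiset.exists_cons_of_mem hI
    obtain ⟨u, rfl⟩ := Multiset.exists_cons_of_mem
      ((Multiset.mem_cons.1 hJ).resolve_left hJI)
    obtain ⟨r, hrp, hrq⟩ := exists_mem_tiles_of_adj hpq
    have hspan := Triangle.span_join_le (hpI hrp) (hqJ hrq)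
    obtain ⟨K, hK, hKE⟩ := ih (I.join J ::ₘ u).card (by rw [← hn]; simp) (I.join J ::ₘ u)
      (by
        intro K hK
        rcases Multiset.mem_cons.1 hK with rfl | hK
        · exact Triangle.span_nonneg_of_mem (Triangle.points_subset_join_left I J (hpI hrp))
        · exact hs K (by simp [hK]))
      (by
        intro x hx
        obtain ⟨K, hK, hxK⟩ := hcov x hx
        rcases Multiset.mem_cons.1 hK with rfl | hK
        · exact ⟨_, by simp, hxK.trans (Triangle.points_subset_join_left _ J)⟩
        rcases Multiset.mem_cons.1 hK with rfl | hK
        · exact ⟨_, by simp, hxK.trans (Triangle.points_subset_join_right I _)⟩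
        · exact ⟨K, by simp [hK], hxK⟩) rfl
    refine ⟨K, hK.trans ?_, hKE⟩
    simp only [Multiset.map_cons, Multiset.sum_cons]
    linarith

/-- The triangle of span `1` whose lattice points form the tile of `p`. -/
noncomputable def tileTriangle (p : ℤ × ℤ) : Triangle := ⟨-p.1, -p.2, p.1 + p.2 + 1⟩

theorem tileTriangle_span (p : ℤ × ℤ) : (tileTriangle p).span = 1 := by
  simp only [tileTriangle, Triangle.span]; ring

theorem tile_subset_tileTriangle (p : ℤ × ℤ) : tile p ⊆ (tileTriangle p).points := by
  rintro ⟨x, y⟩ h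
  obtain ⟨a, b⟩ := p
  rw [mem_tile_iff] at h
  rw [Triangle.mem_points_iff]
  simp only [tileTriangle]
  rcases h with ⟨rfl, rfl⟩ | ⟨rfl, rfl⟩ | ⟨rfl, rfl⟩ <;> push_cast <;>
    refine ⟨?_, ?_, ?_⟩ <;> linarith

theorem bigSpan_mono {E F : Set (ℤ × ℤ)} (h : E ⊆ F) : bigSpan E ≤ bigSpan F :=
  le_iInf₂ fun 𝓘 h𝓘 => iInf₂_le 𝓘 ⟨h𝓘.1, h.trans h𝓘.2⟩

theorem bigSpan_le_of_cover {E : Set (ℤ × ℤ)} {𝓘 : Finset Triangle} {r : ℝ}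
    (h : CoversWithDeflation 𝓘 2 E) (hr : ∑ I ∈ 𝓘, I.span ≤ r) : bigSpan E ≤ (r : EReal) :=
  (iInf₂_le 𝓘 h).trans (EReal.coe_le_coe_iff.2 hr)

theorem exists_cover_of_bigSpan_le {E : Set (ℤ × ℤ)} {r ε : ℝ} (h : bigSpan E ≤ (r : EReal))
    (hε : 0 < ε) : ∃ 𝓘, CoversWithDeflation 𝓘 2 E ∧ ∑ I ∈ 𝓘, I.span < r + ε := by
  have hlt : bigSpan E < ((r + ε : ℝ) : EReal) :=
    h.trans_lt (EReal.coe_lt_coe_iff.2 (by linarith))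
  unfold bigSpan coverSpan at hlt
  simp only [iInf_lt_iff] at hlt
  obtain ⟨𝓘, h𝓘, hs⟩ := hlt
  exact ⟨𝓘, h𝓘, EReal.coe_lt_coe_iff.1 hs⟩

theorem bigSpan_le_of_forall_pos {E : Set (ℤ × ℤ)} {r : ℝ}
    (h : ∀ ε : ℝ, 0 < ε → bigSpan E ≤ ((r + ε : ℝ) : EReal)) : bigSpan E ≤ (r : EReal) := by
  refine EReal.le_of_forall_lt_iff_le.1 fun z hz => ?_
  have := h (z - r) (by have := EReal.coe_lt_coe_iff.1 hz; linarith)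
  simpa using this

theorem bigSpan_union_le {E F : Set (ℤ × ℤ)} {r s : ℝ} (hE : bigSpan E ≤ (r : EReal))
    (hF : bigSpan F ≤ (s : EReal)) : bigSpan (E ∪ F) ≤ ((r + s : ℝ) : EReal) := by
  classical
  refine bigSpan_le_of_forall_pos fun ε hε => ?_
  obtain ⟨𝓘, h𝓘, hs⟩ := exists_cover_of_bigSpan_le hE (half_pos hε)
  obtain ⟨𝓙, h𝓙, ht⟩ := exists_cover_of_bigSpan_le hF (half_pos hε)
  refine bigSpan_le_of_cover (𝓘 := 𝓘 ∪ 𝓙) ⟨?_, ?_⟩ ?_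
  · intro I hI
    exact (Finset.mem_union.1 hI).elim (h𝓘.1 I) (h𝓙.1 I)
  · rw [Finset.set_biUnion_union]
    exact Set.union_subset_union h𝓘.2 h𝓙.2
  · have h1 := Finset.sum_union_inter (s₁ := 𝓘) (s₂ := 𝓙) (f := Triangle.span)
    have h2 : 0 ≤ ∑ I ∈ 𝓘 ∩ 𝓙, I.span :=
      Finset.sum_nonneg fun I hI => h𝓘.1 I (Finset.mem_inter.1 hI).1
    linarith

theorem bigSpan_empty_le : bigSpan ∅ ≤ ((0 : ℝ) : EReal) :=
  bigSpan_le_of_cover (𝓘 := ∅) ⟨by simp, by simp⟩ (by simp)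

theorem bigSpan_le_of_subset_points {E : Set (ℤ × ℤ)} {I : Triangle} (hI : 0 ≤ I.span)
    (h : E ⊆ I.points) : bigSpan E ≤ ((I.span + 6 : ℝ) : EReal) := by
  refine bigSpan_le_of_cover (𝓘 := {⟨I.a + 2, I.b + 2, I.c + 2⟩}) ⟨?_, ?_⟩ ?_
  · simp only [Finset.mem_singleton, forall_eq]
    unfold Triangle.span at hI ⊢
    dsimp only
    linarith
  · simpa [Triangle.deflate] using h
  · simp only [Finset.sum_singleton, Triangle.span]
    linarith

/-- The eastern neighbour has a larger `x + y` by one, which leaves slack in the third constraint.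
This unit is what lowers the price of inflation from 6 to 5. -/
theorem Triangle.subset_of_tile_subset {I : Triangle} {p : ℤ × ℤ} (h : tile p ⊆ I.points) :
    p ∈ (⟨I.a, I.b, I.c - 1⟩ : Triangle).points := by
  obtain ⟨x, y⟩ := p
  have h1 := h (self_mem_tile (x, y))
  have h2 := h ((mem_tile_iff x y (x + 1) y).2 (by omega))
  rw [Triangle.mem_points_iff] at h1 h2 ⊢
  push_cast at h2
  exact ⟨h1.1, h1.2.1, by linarith⟩

theorem bigSpan_le_of_tiles_subset {E : Set (ℤ × ℤ)} {I : Triangle} (hne : E.Nonempty)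
    (h : ∀ p ∈ E, tile p ⊆ I.points) : bigSpan E ≤ ((I.span + 5 : ℝ) : EReal) := by
  have hsub : E ⊆ (⟨I.a, I.b, I.c - 1⟩ : Triangle).points :=
    fun p hp => Triangle.subset_of_tile_subset (h p hp)
  obtain ⟨p, hp⟩ := hne
  have := bigSpan_le_of_subset_points (Triangle.span_nonneg_of_mem (hsub hp)) hsub
  refine this.trans (EReal.coe_le_coe_iff.2 ?_)
  simp only [Triangle.span]
  linarith

/-- A finite connected set lies in a triangle of span less than its cardinality. -/
theorem exists_triangle_of_finset {K : Finset (ℤ × ℤ)}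
    (hK : Indecomposable (K : Set (ℤ × ℤ))) (hne : K.Nonempty) :
    ∃ J : Triangle, 0 ≤ J.span ∧ J.span + 1 ≤ K.card ∧ (K : Set (ℤ × ℤ)) ⊆ J.points := by
  obtain ⟨J, hJ, hKJ⟩ := exists_triangle_of_indecomposable hK hne (K.val.map tileTriangle)
    (by
      intro I hI
      obtain ⟨p, -, rfl⟩ := Multiset.mem_map.1 hI
      rw [tileTriangle_span]
      exact zero_le_one)
    (fun p hp => ⟨_, Multiset.mem_map_of_mem _ hp, tile_subset_tileTriangle p⟩)
  have hsub : (K : Set (ℤ × ℤ)) ⊆ (⟨J.a, J.b, J.c - 1⟩ : Triangle).points :=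
    fun p hp => Triangle.subset_of_tile_subset (hKJ p hp)
  obtain ⟨p, hp⟩ := hne
  refine ⟨_, Triangle.span_nonneg_of_mem (hsub hp), ?_, hsub⟩
  have hsum : ((K.val.map tileTriangle).map Triangle.span).sum = K.card := by
    simp [Multiset.map_map, tileTriangle_span]
  rw [hsum] at hJ
  simp only [Triangle.span] at hJ ⊢
  linarith

/-! ### Splits -/

/-- A cut of `S` whose three parts exhaust `S`. -/
structure IsSplit (S : Set (ℤ × ℤ)) (C : Finset (ℤ × ℤ)) (A B : Set (ℤ × ℤ)) : Prop where
  mem_iff : ∀ p, p ∈ S ↔ p ∈ A ∨ p ∈ B ∨ p ∈ C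
  notMem_C_of_left : ∀ p ∈ A, p ∉ C
  notMem_C_of_right : ∀ p ∈ B, p ∉ C
  notMem_right_of_left : ∀ p ∈ A, p ∉ B
  not_adj : ∀ p ∈ A, ∀ q ∈ B, ¬ toomGraph.Adj p q

theorem IsSplit.swap {S : Set (ℤ × ℤ)} {C : Finset (ℤ × ℤ)} {A B : Set (ℤ × ℤ)}
    (h : IsSplit S C A B) : IsSplit S C B A where
  mem_iff p := by rw [h.mem_iff]; tauto
  notMem_C_of_left := h.notMem_C_of_right
  notMem_C_of_right := h.notMem_C_of_left
  notMem_right_of_left p hB hA := h.notMem_right_of_left p hA hB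
  not_adj p hp q hq hpq := h.not_adj q hq p hp hpq.symm

theorem IsSplit.isCut {S : Set (ℤ × ℤ)} {C : Finset (ℤ × ℤ)} {A B : Set (ℤ × ℤ)}
    (h : IsSplit S C A B) : IsCut S C A B where
  subset_C p hp := (h.mem_iff p).2 (Or.inr (Or.inr hp))
  subset_left p hp := (h.mem_iff p).2 (Or.inl hp)
  subset_right p hp := (h.mem_iff p).2 (Or.inr (Or.inl hp))
  disjoint_C_left := Set.disjoint_right.2 h.notMem_C_of_left
  disjoint_C_right := Set.disjoint_right.2 h.notMem_C_of_right
  disjoint_left_right := Set.disjoint_left.2 h.notMem_right_of_left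
  separates := by
    intro a ha b hb w hw
    induction w with
    | nil => exact absurd hb (h.notMem_right_of_left _ ha)
    | @cons u v _ huv w ih =>
      have hvS : v ∈ S := hw v (by simp)
      rcases (h.mem_iff v).1 hvS with hv | hv | hv
      · obtain ⟨x, hx, hxC⟩ := ih hv hb fun x hx => hw x (by simp [hx])
        exact ⟨x, by simp [hx], hxC⟩
      · exact absurd huv (h.not_adj u ha v hv)
      · exact ⟨v, by simp, hv⟩

/-- Enlarge `A` to everything reachable from it in `S` off `C`, and `B` to all the rest of `S` off
`C`. Spans can only grow. -/
theorem IsCut.exists_isSplit {S : Set (ℤ × ℤ)} {C : Finset (ℤ × ℤ)} {A B : Set (ℤ × ℤ)}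
    (h : IsCut S C A B) : ∃ A' B', IsSplit S C A' B' ∧ A ⊆ A' ∧ B ⊆ B' := by
  let A' : Set (ℤ × ℤ) := {p | ∃ a ∈ A, ∃ w : toomGraph.Walk a p, ∀ v ∈ w.support, v ∈ S ∧ v ∉ C}
  have hA' : ∀ p ∈ A', p ∈ S ∧ p ∉ C := by
    rintro p ⟨a, -, w, hw⟩
    exact hw p w.end_mem_support
  refine ⟨A', {p | p ∈ S ∧ p ∉ C ∧ p ∉ A'}, ⟨?_, fun p hp => (hA' p hp).2, fun p hp => hp.2.1,
    fun p hp hp' => hp'.2.2 hp, ?_⟩, ?_, ?_⟩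
  · intro p
    constructor
    · intro hp
      by_cases hC : p ∈ C
      · exact Or.inr (Or.inr hC)
      · by_cases hpA : p ∈ A'
        · exact Or.inl hpA
        · exact Or.inr (Or.inl ⟨hp, hC, hpA⟩)
    · rintro (hp | hp | hp)
      · exact (hA' p hp).1
      · exact hp.1
      · exact h.subset_C hp
  · rintro p ⟨a, ha, w, hw⟩ q ⟨hqS, hqC, hqA⟩ hpq
    refine hqA ⟨a, ha, w.concat hpq, fun v hv => ?_⟩
    rw [SimpleGraph.Walk.support_concat, List.mem_append, List.mem_singleton] at hv
    rcases hv with hv | rfl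
    · exact hw v hv
    · exact ⟨hqS, hqC⟩
  · intro a ha
    refine ⟨a, ha, .nil, fun v hv => ?_⟩
    rw [SimpleGraph.Walk.support_nil, List.mem_singleton] at hv
    rw [hv]
    exact ⟨h.subset_left ha, Set.disjoint_right.1 h.disjoint_C_left ha⟩
  · intro b hb
    refine ⟨h.subset_right hb, Set.disjoint_right.1 h.disjoint_C_right hb, ?_⟩
    rintro ⟨a, ha, w, hw⟩
    obtain ⟨v, hv, hvC⟩ := h.separates a ha b hb w fun v hv => (hw v hv).1
    exact (hw v hv).2 hvC

/-- `S` has a split by `k` points both of whose sides have span exceeding `6 k`. -/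
def HasWideSplit (S : Set (ℤ × ℤ)) (k : ℕ) : Prop :=
  ∃ (C : Finset (ℤ × ℤ)) (A B : Set (ℤ × ℤ)), IsSplit S C A B ∧ C.card = k ∧
    ((6 * (k : ℝ) : ℝ) : EReal) < bigSpan (A ∪ ↑C) ∧
    ((6 * (k : ℝ) : ℝ) : EReal) < bigSpan (B ∪ ↑C)

theorem HasWideSplit.thickness_le {S : Set (ℤ × ℤ)} {k : ℕ} (h : HasWideSplit S k) :
    thickness S 6 ≤ k := by
  obtain ⟨C, A, B, hs, rfl, hA, hB⟩ := h
  exact sInf_le ⟨C, A, B, hs.isCut, rfl, lt_min hA hB⟩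

theorem exists_hasWideSplit_of_thickness_ne_top {S : Set (ℤ × ℤ)} (h : thickness S 6 ≠ ⊤) :
    ∃ k : ℕ, thickness S 6 = k ∧ HasWideSplit S k := by
  have hne : {k : ℕ∞ | ∃ (C : Finset (ℤ × ℤ)) (A₁ A₂ : Set (ℤ × ℤ)), IsCut S C A₁ A₂ ∧
      k = (C.card : ℕ∞) ∧ (((6 : ℝ) * (C.card : ℝ) : ℝ) : EReal) <
        min (bigSpan (A₁ ∪ ↑C)) (bigSpan (A₂ ∪ ↑C))}.Nonempty := by
    by_contra hcon
    rw [Set.not_nonempty_iff_eq_empty] at hcon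
    apply h
    rw [thickness, hcon, sInf_empty]
  obtain ⟨C, A, B, hcut, hk, hlt⟩ := csInf_mem hne
  obtain ⟨A', B', hs, hA, hB⟩ := hcut.exists_isSplit
  refine ⟨C.card, hk, C, A', B', hs, rfl, ?_, ?_⟩
  · exact (hlt.trans_le (min_le_left _ _)).trans_le
      (bigSpan_mono (Set.union_subset_union_left _ hA))
  · exact (hlt.trans_le (min_le_right _ _)).trans_le
      (bigSpan_mono (Set.union_subset_union_left _ hB))

/-- In a smallest wide split, each side together with the cut is connected. -/
theorem IsSplit.indecomposable_left {S : Set (ℤ × ℤ)} {C : Finset (ℤ × ℤ)} {A B : Set (ℤ × ℤ)}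
    (h : IsSplit S C A B) (hS : Indecomposable S)
    (hA : ((6 * (C.card : ℝ) : ℝ) : EReal) < bigSpan (A ∪ ↑C))
    (hB : ((6 * (C.card : ℝ) : ℝ) : EReal) < bigSpan (B ∪ ↑C))
    (hmin : ∀ m < C.card, ¬ HasWideSplit S m) : Indecomposable (A ∪ ↑C : Set (ℤ × ℤ)) := by
  classical
  have hES : A ∪ ↑C ⊆ S := by
    rintro p (hp | hp)
    · exact (h.mem_iff p).2 (Or.inl hp)
    · exact (h.mem_iff p).2 (Or.inr (Or.inr hp))
  have hAnbr : ∀ p ∈ A, ∀ q ∈ S, toomGraph.Adj p q → q ∈ A ∪ (C : Set (ℤ × ℤ)) := by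
    intro p hp q hq hpq
    rcases (h.mem_iff q).1 hq with hq | hq | hq
    · exact Or.inl hq
    · exact absurd hpq (h.not_adj p hp q hq)
    · exact Or.inr hq
  -- A closed piece disjoint from `C` would lie in `A` and be closed in all of `S`.
  have meets : ∀ X ⊆ A ∪ (C : Set (ℤ × ℤ)), X.Nonempty → (∃ p ∈ S, p ∉ X) →
      (∀ p ∈ X, ∀ q ∈ A ∪ (C : Set (ℤ × ℤ)), toomGraph.Adj p q → q ∈ X) → ∃ p ∈ C, p ∈ X := by
    rintro X hX hne ⟨x, hxS, hxX⟩ hcl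
    by_contra hcon
    push Not at hcon
    refine hxX (hS X (hX.trans hES) hne ?_ hxS)
    intro p hp q hq hpq
    have hpA : p ∈ A := (hX hp).resolve_right fun hpC => hcon p hpC hp
    exact hcl p hp q (hAnbr p hpA q hq hpq) hpq
  have small : ∀ X ⊆ A ∪ (C : Set (ℤ × ℤ)), (∃ p ∈ C, p ∉ X) →
      (∀ p ∈ X, ∀ q ∈ A ∪ (C : Set (ℤ × ℤ)), toomGraph.Adj p q → q ∈ X) →
      bigSpan X ≤ ((6 * ((C.filter (· ∈ X)).card : ℝ) : ℝ) : EReal) := by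
    rintro X hX ⟨x, hxC, hxX⟩ hcl
    have hlt : (C.filter (· ∈ X)).card < C.card :=
      Finset.card_lt_card (Finset.filter_ssubset.2 ⟨x, hxC, hxX⟩)
    have hlt' : ((C.filter (· ∈ X)).card : ℝ) ≤ C.card := by exact_mod_cast hlt.le
    by_contra hcon
    rw [not_le] at hcon
    -- The smaller cut `C ∩ X` separates `A ∩ X` from `S \ X`. The second side together with the cut
    -- contains `B ∪ C`, hence is wide, so minimality bounds the span of the first.
    refine hmin _ hlt ⟨C.filter (· ∈ X), A ∩ X, {p | p ∈ S ∧ p ∉ X}, ⟨?_, ?_, ?_, ?_, ?_⟩,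
      rfl, hcon.trans_le (bigSpan_mono ?_), lt_of_le_of_lt ?_ (hB.trans_le (bigSpan_mono ?_))⟩
    · intro p
      constructor
      · intro hp
        by_cases hpX : p ∈ X
        · rcases hX hpX with hpA | hpC
          · exact Or.inl ⟨hpA, hpX⟩
          · exact Or.inr (Or.inr (Finset.mem_filter.2 ⟨hpC, hpX⟩))
        · exact Or.inr (Or.inl ⟨hp, hpX⟩)
      · rintro (hp | hp | hp)
        · exact hES (Or.inl hp.1)
        · exact hp.1
        · exact hES (Or.inr (Finset.mem_filter.1 hp).1)
    · exact fun p hp hpC => h.notMem_C_of_left p hp.1 (Finset.mem_filter.1 hpC).1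
    · exact fun p hp hpC => hp.2 (Finset.mem_filter.1 hpC).2
    · exact fun p hp hp' => hp'.2 hp.2
    · exact fun p hp q hq hpq => hq.2 (hcl p hp.2 q (hAnbr p hp.1 q hq.1 hpq) hpq)
    · intro p hp
      rcases hX hp with hpA | hpC
      · exact Or.inl ⟨hpA, hp⟩
      · exact Or.inr (by simpa using ⟨hpC, hp⟩)
    · exact EReal.coe_le_coe_iff.2 (by linarith)
    · intro p hp
      by_cases hpX : p ∈ X
      · rcases hp with hpB | hpC
        · rcases hX hpX with hpA | hpC
          · exact absurd hpB (h.notMem_right_of_left p hpA)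
          · exact absurd hpC (h.notMem_C_of_right p hpB)
        · exact Or.inr (by simpa using ⟨hpC, hpX⟩)
      · refine Or.inl ⟨?_, hpX⟩
        rcases hp with hpB | hpC
        · exact (h.mem_iff p).2 (Or.inr (Or.inl hpB))
        · exact hES (Or.inr hpC)
  intro X hX hne hcl
  by_contra hcon
  obtain ⟨y, hyE, hyX⟩ := Set.not_subset.1 hcon
  let Y : Set (ℤ × ℤ) := {p | p ∈ A ∪ (C : Set (ℤ × ℤ)) ∧ p ∉ X}
  have hYE : Y ⊆ A ∪ (C : Set (ℤ × ℤ)) := fun p hp => hp.1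
  have hYcl : ∀ p ∈ Y, ∀ q ∈ A ∪ (C : Set (ℤ × ℤ)), toomGraph.Adj p q → q ∈ Y :=
    fun p hp q hq hpq => ⟨hq, fun hqX => hp.2 (hcl q hqX p hp.1 hpq.symm)⟩
  obtain ⟨c, hcC, hcX⟩ := meets X hX hne ⟨y, hES hyE, hyX⟩ hcl
  obtain ⟨d, hdC, hdY⟩ := meets Y hYE ⟨y, hyE, hyX⟩
    ⟨c, hES (Or.inr hcC), fun hcY => hcY.2 hcX⟩ hYcl
  -- The two pieces share out the points of `C`, so their bounds add up to `6 |C|`, against the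
  -- width of `A ∪ C`.
  have hspan := bigSpan_union_le (small X hX ⟨d, hdC, hdY.2⟩ hcl)
    (small Y hYE ⟨c, hcC, fun hcY => hcY.2 hcX⟩ hYcl)
  have hcard : (C.filter (· ∈ X)).card + (C.filter (· ∈ Y)).card = C.card := by
    rw [← Finset.card_filter_add_card_filter_not (s := C) (· ∈ X)]
    congr 2
    refine Finset.filter_congr fun p hp => ?_
    exact ⟨fun hpY => hpY.2, fun hpX => ⟨Or.inr hp, hpX⟩⟩
  have hcard' : ((C.filter (· ∈ X)).card : ℝ) + (C.filter (· ∈ Y)).card = C.card := by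
    exact_mod_cast hcard
  have hspan' : bigSpan (X ∪ Y) ≤ ((6 * (C.card : ℝ) : ℝ) : EReal) := by
    rw [← hcard', mul_add]
    convert hspan
  refine absurd (hA.trans_le (bigSpan_mono ?_)) (not_lt.2 hspan')
  intro p hp
  by_cases hpX : p ∈ X
  · exact Or.inl hpX
  · exact Or.inr ⟨hp, hpX⟩

/-! ### Pulling a split back through Toom's rule -/

/-- At most three points are coloured by membership in `T`, so deleting a suitable one leaves a
single colour. Each cut point of `toom W` can thus be traded for one cut point of `W`. -/
theorem exists_minority {W T : Set (ℤ × ℤ)} {p : ℤ × ℤ} (hp : p ∈ toom W) :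
    ∃ c ∈ tile p, c ∈ W ∧ ∀ q ∈ tile p, ∀ r ∈ tile p, q ∈ W → r ∈ W → q ≠ c → r ≠ c →
      q ∈ T → r ∈ T := by
  obtain ⟨u, hu, v, hv, huW, hvW, huv⟩ := mem_toom_iff.1 hp
  have third : ∃ w, ∀ q ∈ tile p, q = u ∨ q = v ∨ q = w := by
    obtain ⟨a, b⟩ := p
    obtain ⟨c, d⟩ := u
    obtain ⟨e, f⟩ := v
    -- The three points of the tile sum to `(3a + 1, 3b + 1)`.
    refine ⟨(3 * a + 1 - c - e, 3 * b + 1 - d - f), ?_⟩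
    rintro ⟨x, y⟩ hq
    rw [mem_tile_iff] at hu hv hq
    simp only [ne_eq, Prod.mk.injEq] at huv ⊢
    omega
  obtain ⟨w, hw⟩ := third
  by_cases hwW : w ∈ W ∧ w ∈ tile p
  · by_cases h1 : u ∈ T ↔ v ∈ T
    · refine ⟨w, hwW.2, hwW.1, fun q hq r hr _ _ hqw hrw => ?_⟩
      rcases hw q hq with rfl | rfl | rfl <;> rcases hw r hr with rfl | rfl | rfl <;> tauto
    · by_cases h2 : u ∈ T ↔ w ∈ T
      · refine ⟨v, hv, hvW, fun q hq r hr _ _ hqw hrw => ?_⟩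
        rcases hw q hq with rfl | rfl | rfl <;> rcases hw r hr with rfl | rfl | rfl <;> tauto
      · refine ⟨u, hu, huW, fun q hq r hr _ _ hqw hrw => ?_⟩
        rcases hw q hq with rfl | rfl | rfl <;> rcases hw r hr with rfl | rfl | rfl <;> tauto
  · refine ⟨u, hu, huW, fun q hq r hr hqW hrW hqw hrw => ?_⟩
    rcases hw q hq with rfl | rfl | rfl <;> rcases hw r hr with rfl | rfl | rfl <;> tauto

/-- Colour `W` by membership in the tiles of `A`, and let the minority points of the tiles of `C` be
the new cut. An edge of `W` lies in a tile based in `toom W`: over `A` or `B` that tile has one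
colour, and over `C` it has one after deletion of its minority point. -/
theorem IsSplit.exists_lift {W : Set (ℤ × ℤ)} {C : Finset (ℤ × ℤ)} {A B : Set (ℤ × ℤ)}
    (h : IsSplit (toom W) C A B) :
    ∃ (C' : Finset (ℤ × ℤ)) (A' B' : Set (ℤ × ℤ)), IsSplit W C' A' B' ∧ C'.card ≤ C.card ∧
      (∀ p ∈ A ∪ (C : Set (ℤ × ℤ)), ∃ v ∈ A' ∪ (C' : Set (ℤ × ℤ)), v ∈ tile p) ∧
      (∀ p ∈ B ∪ (C : Set (ℤ × ℤ)), ∃ v ∈ B' ∪ (C' : Set (ℤ × ℤ)), v ∈ tile p) := by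
  classical
  let T : Set (ℤ × ℤ) := {v | ∃ p ∈ A, v ∈ tile p}
  have hCW : ∀ p : C, (p : ℤ × ℤ) ∈ toom W := fun p => (h.mem_iff p).2 (Or.inr (Or.inr p.2))
  choose c hct hcW hc using fun p : C => exists_minority (T := T) (hCW p)
  have hBT : ∀ p ∈ B, ∀ v ∈ tile p, v ∉ T := by
    rintro p hp v hv ⟨q, hq, hvq⟩
    by_cases hne : q = p
    · exact h.notMem_right_of_left q hq (hne ▸ hp)
    · exact h.not_adj q hq p hp (adj_of_tiles_meet hvq hv hne)
  let C' : Finset (ℤ × ℤ) := C.attach.image c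
  have hcC' : ∀ p, c p ∈ C' := fun p => Finset.mem_image_of_mem c (Finset.mem_attach _ p)
  refine ⟨C', {v | v ∈ W ∧ v ∉ C' ∧ v ∈ T}, {v | v ∈ W ∧ v ∉ C' ∧ v ∉ T},
    ⟨?_, fun p hp => hp.2.1, fun p hp => hp.2.1, fun p hp hp' => hp'.2.2 hp.2.2, ?_⟩,
    Finset.card_image_le.trans_eq C.card_attach, ?_, ?_⟩
  · intro v
    constructor
    · intro hv
      by_cases hvC : v ∈ C'
      · exact Or.inr (Or.inr hvC)
      · by_cases hvT : v ∈ T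
        · exact Or.inl ⟨hv, hvC, hvT⟩
        · exact Or.inr (Or.inl ⟨hv, hvC, hvT⟩)
    · rintro (hv | hv | hv)
      · exact hv.1
      · exact hv.1
      · obtain ⟨p, -, rfl⟩ := Finset.mem_image.1 hv
        exact hcW p
  · rintro v ⟨hvW, hvC, hvT⟩ w ⟨hwW, hwC, hwT⟩ hvw
    obtain ⟨p, hvp, hwp⟩ := exists_tile_of_adj hvw
    have hpW : p ∈ toom W := mem_toom_iff.2 ⟨v, hvp, w, hwp, hvW, hwW, hvw.ne⟩
    rcases (h.mem_iff p).1 hpW with hp | hp | hp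
    · exact hwT ⟨p, hp, hwp⟩
    · exact hBT p hp v hvp hvT
    · exact hwT (hc ⟨p, hp⟩ v hvp w hwp hvW hwW (fun e => hvC (e ▸ hcC' _))
        (fun e => hwC (e ▸ hcC' _)) hvT)
  · rintro p (hp | hp)
    · obtain ⟨v, hv, -, -, hvW, -⟩ := mem_toom_iff.1 ((h.mem_iff p).2 (Or.inl hp))
      by_cases hvC : v ∈ C'
      · exact ⟨v, Or.inr hvC, hv⟩
      · exact ⟨v, Or.inl ⟨hvW, hvC, p, hp, hv⟩, hv⟩
    · exact ⟨c ⟨p, hp⟩, Or.inr (hcC' _), hct ⟨p, hp⟩⟩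
  · rintro p (hp | hp)
    · obtain ⟨v, hv, -, -, hvW, -⟩ := mem_toom_iff.1 ((h.mem_iff p).2 (Or.inr (Or.inl hp)))
      by_cases hvC : v ∈ C'
      · exact ⟨v, Or.inr hvC, hv⟩
      · exact ⟨v, Or.inl ⟨hvW, hvC, hBT p hp v hv⟩, hv⟩
    · exact ⟨c ⟨p, hp⟩, Or.inr (hcC' _), hct ⟨p, hp⟩⟩

/-! ### Pulling a split back through inflation -/

theorem add_sub_mem_tile {p r : ℤ × ℤ} (h : p ∈ tile r) (u : ℤ × ℤ) : u + (p - r) ∈ tile u := by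
  obtain ⟨a, b⟩ := p; obtain ⟨c, d⟩ := r; obtain ⟨e, f⟩ := u
  rw [mem_tile_iff] at h
  rw [Prod.mk_sub_mk, Prod.mk_add_mk, mem_tile_iff]
  omega

/-- The translation `u ↦ u + (p - r)` embeds `U` in `inflate U` and preserves adjacency, so the
split pulls back. The cut point `p` would come from `r ∉ U`, so it is lost; `F` collects all the
lost cut points. -/
theorem IsSplit.exists_shift {U : Set (ℤ × ℤ)} {C : Finset (ℤ × ℤ)} {A B : Set (ℤ × ℤ)}
    (h : IsSplit (inflate U) C A B) {p r : ℤ × ℤ} (hp : p ∈ C) (hpr : p ∈ tile r) (hr : r ∉ U) :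
    ∃ (C' F : Finset (ℤ × ℤ)) (A' B' : Set (ℤ × ℤ)), IsSplit U C' A' B' ∧
      C'.card + F.card = C.card ∧ F.Nonempty ∧
      (∀ q ∈ A ∪ (C : Set (ℤ × ℤ)), q ∈ F ∨ ∃ u ∈ A' ∪ (C' : Set (ℤ × ℤ)), q ∈ tile u) ∧
      (∀ q ∈ B ∪ (C : Set (ℤ × ℤ)), q ∈ F ∨ ∃ u ∈ B' ∪ (C' : Set (ℤ × ℤ)), q ∈ tile u) := by
  classical
  obtain ⟨v, hv⟩ : ∃ v, v = p - r := ⟨_, rfl⟩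
  have hvt : ∀ u, u + v ∈ tile u := fun u => hv ▸ add_sub_mem_tile hpr u
  let C' : Finset (ℤ × ℤ) := (C.filter (· - v ∈ U)).image (· - v)
  let F : Finset (ℤ × ℤ) := C.filter (¬ · - v ∈ U)
  have hC' : ∀ u, u ∈ C' ↔ u ∈ U ∧ u + v ∈ C := by
    intro u
    simp only [C', Finset.mem_image, Finset.mem_filter]
    constructor
    · rintro ⟨q, ⟨hq, hqU⟩, rfl⟩
      exact ⟨hqU, by rwa [sub_add_cancel]⟩
    · rintro ⟨hu, huC⟩
      exact ⟨u + v, ⟨huC, by rwa [add_sub_cancel_right]⟩, add_sub_cancel_right _ _⟩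
  have cover : ∀ D E : Set (ℤ × ℤ), IsSplit (inflate U) C D E →
      ∀ q ∈ D ∪ (C : Set (ℤ × ℤ)), q ∈ F ∨
        ∃ u ∈ {u | u ∈ U ∧ u + v ∈ D} ∪ (C' : Set (ℤ × ℤ)), q ∈ tile u := by
    intro D E hs q hq
    have lift : ∀ u ∈ U, u + v ∈ D ∪ (C : Set (ℤ × ℤ)) →
        u ∈ {u | u ∈ U ∧ u + v ∈ D} ∪ (C' : Set (ℤ × ℤ)) := by
      rintro u hu (hD | hC)
      · exact Or.inl ⟨hu, hD⟩
      · exact Or.inr ((hC' u).2 ⟨hu, hC⟩)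
    by_cases hqU : q - v ∈ U
    · refine Or.inr ⟨q - v, lift _ hqU (by rwa [sub_add_cancel]), ?_⟩
      simpa using hvt (q - v)
    · by_cases hqC : q ∈ C
      · exact Or.inl (Finset.mem_filter.2 ⟨hqC, hqU⟩)
      · have hqD : q ∈ D := hq.resolve_right hqC
        obtain ⟨u, hu, hqu⟩ := mem_inflate_iff.1 ((hs.mem_iff q).2 (Or.inl hqD))
        refine Or.inr ⟨u, lift u hu ?_, hqu⟩
        -- Both `q` and `u + v` lie in the tile of `u`, so they are equal or adjacent and `u + v`
        -- cannot be on the other side.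
        by_cases hne : q = u + v
        · exact hne ▸ hq
        · rcases (hs.mem_iff (u + v)).1 (mem_inflate_iff.2 ⟨u, hu, hvt u⟩) with h' | h' | h'
          · exact Or.inl h'
          · exact absurd (adj_of_mem_tile hqu (hvt u) hne) (hs.not_adj q hqD _ h')
          · exact Or.inr h'
  refine ⟨C', F, {u | u ∈ U ∧ u + v ∈ A}, {u | u ∈ U ∧ u + v ∈ B}, ⟨?_, ?_, ?_, ?_, ?_⟩, ?_, ?_,
    cover A B h, cover B A h.swap⟩
  · intro u
    rw [hC']
    constructor
    · intro hu
      rcases (h.mem_iff (u + v)).1 (mem_inflate_iff.2 ⟨u, hu, hvt u⟩) with h' | h' | h'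
      · exact Or.inl ⟨hu, h'⟩
      · exact Or.inr (Or.inl ⟨hu, h'⟩)
      · exact Or.inr (Or.inr ⟨hu, h'⟩)
    · rintro (h' | h' | h') <;> exact h'.1
  · exact fun u hu huC => h.notMem_C_of_left _ hu.2 ((hC' u).1 huC).2
  · exact fun u hu huC => h.notMem_C_of_right _ hu.2 ((hC' u).1 huC).2
  · exact fun u hu huB => h.notMem_right_of_left _ hu.2 huB.2
  · exact fun a ha b hb hab => h.not_adj _ ha.2 _ hb.2 ((adj_add_right_iff v).2 hab)
  · rw [Finset.card_image_of_injective _ (sub_left_injective (b := v))]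
    exact Finset.card_filter_add_card_filter_not _
  · exact ⟨p, Finset.mem_filter.2 ⟨hp, by rwa [hv, sub_sub_cancel]⟩⟩

/-- Passing from `x` back to a point of the tile of `p` lowers each coordinate by at most 2 and
raises `x + y` by at most 2. This is why the spans use deflation by exactly 2. -/
theorem tile_subset_of_mem_deflate {I : Triangle} {p u w x : ℤ × ℤ} (hp : p ∈ tile u)
    (hw : w ∈ tile u) (hx : x ∈ tile w) (hI : x ∈ (I.deflate 2).points) :
    tile p ⊆ I.points := by
  obtain ⟨p₁, p₂⟩ := p; obtain ⟨u₁, u₂⟩ := u; obtain ⟨w₁, w₂⟩ := w; obtain ⟨x₁, x₂⟩ := x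
  rintro ⟨q₁, q₂⟩ hq
  rw [mem_tile_iff] at hp hw hx hq
  have h1 : x₁ - 2 ≤ q₁ := by omega
  have h2 : x₂ - 2 ≤ q₂ := by omega
  have h3 : q₁ + q₂ ≤ x₁ + x₂ + 2 := by omega
  have h1' : (x₁ : ℝ) - 2 ≤ q₁ := by exact_mod_cast h1
  have h2' : (x₂ : ℝ) - 2 ≤ q₂ := by exact_mod_cast h2
  have h3' : (q₁ : ℝ) + q₂ ≤ x₁ + x₂ + 2 := by exact_mod_cast h3
  rw [Triangle.mem_points_iff] at hI ⊢
  simp only [Triangle.deflate] at hI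
  exact ⟨by linarith, by linarith, by linarith⟩

/-- The span of a connected set all but finitely many of whose points lie near `X`. -/
theorem bigSpan_le_of_near {E X : Set (ℤ × ℤ)} {F : Finset (ℤ × ℤ)} {r : ℝ}
    (hE : Indecomposable E) (hne : E.Nonempty) (hX : bigSpan X ≤ (r : EReal))
    (hnear : ∀ p ∈ E, p ∈ F ∨ ∃ u w x, p ∈ tile u ∧ w ∈ tile u ∧ x ∈ tile w ∧ x ∈ X) :
    bigSpan E ≤ ((r + F.card + 5 : ℝ) : EReal) := by
  refine bigSpan_le_of_forall_pos fun ε hε => ?_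
  obtain ⟨𝓘, h𝓘, hs⟩ := exists_cover_of_bigSpan_le hX hε
  obtain ⟨J, hJ, hJE⟩ := exists_triangle_of_indecomposable hE hne
    (𝓘.val + F.val.map tileTriangle)
    (by
      intro I hI
      rcases Multiset.mem_add.1 hI with hI | hI
      · exact h𝓘.1 I hI
      · obtain ⟨p, -, rfl⟩ := Multiset.mem_map.1 hI
        rw [tileTriangle_span]
        exact zero_le_one)
    (by
      intro p hp
      rcases hnear p hp with hpF | ⟨u, w, x, hpu, hwu, hxw, hxX⟩
      · exact ⟨_, Multiset.mem_add.2 (Or.inr (Multiset.mem_map_of_mem _ hpF)),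
          tile_subset_tileTriangle p⟩
      · obtain ⟨I, hI, hxI⟩ := Set.mem_iUnion₂.1 (h𝓘.2 hxX)
        exact ⟨I, Multiset.mem_add.2 (Or.inl hI), tile_subset_of_mem_deflate hpu hwu hxw hxI⟩)
  have hsum : ((𝓘.val + F.val.map tileTriangle).map Triangle.span).sum =
      ∑ I ∈ 𝓘, I.span + F.card := by
    rw [Multiset.map_add, Multiset.sum_add]
    congr 1
    simp [Multiset.map_map, tileTriangle_span]
  rw [hsum] at hJ
  exact (bigSpan_le_of_tiles_subset hne hJE).trans (EReal.coe_le_coe_iff.2 (by linarith))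

/-! ### Potentials on the lattice -/

theorem exists_int_antiderivative (a : ℤ → ℤ) : ∃ f : ℤ → ℤ, f 0 = 0 ∧
    ∀ n, f (n + 1) = f n + a n := by
  refine ⟨fun n => ∑ i ∈ Finset.Ico 0 n, a i - ∑ i ∈ Finset.Ico n 0, a i, by simp, fun n => ?_⟩
  rcases le_or_gt 0 n with hn | hn
  · have h1 : Finset.Ico 0 (n + 1) = insert n (Finset.Ico 0 n) := by
      ext x; simp only [Finset.mem_Ico, Finset.mem_insert]; omega
    have h2 : Finset.Ico n 0 = ∅ := Finset.Ico_eq_empty (by omega)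
    have h3 : Finset.Ico (n + 1) 0 = ∅ := Finset.Ico_eq_empty (by omega)
    simp only [h1, h2, h3, Finset.sum_empty]
    rw [Finset.sum_insert (by simp)]
    ring
  · have h1 : Finset.Ico n 0 = insert n (Finset.Ico (n + 1) 0) := by
      ext x; simp only [Finset.mem_Ico, Finset.mem_insert]; omega
    have h2 : Finset.Ico 0 n = ∅ := Finset.Ico_eq_empty (by omega)
    have h3 : Finset.Ico 0 (n + 1) = ∅ := Finset.Ico_eq_empty (by omega)
    simp only [h1, h2, h3, Finset.sum_empty]
    rw [Finset.sum_insert (by simp)]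
    ring

/-- An antisymmetric function on edges whose sum around every triangle vanishes is a gradient. -/
theorem exists_potential (g : ℤ × ℤ → ℤ × ℤ → ℤ) (hanti : ∀ p q, g q p = -g p q)
    (hcl : ∀ p q r, toomGraph.Adj p q → toomGraph.Adj q r → toomGraph.Adj p r →
      g p q + g q r = g p r) :
    ∃ h : ℤ × ℤ → ℤ, ∀ p q, toomGraph.Adj p q → h q = h p + g p q := by
  -- Integrate along the horizontal axis, then up and down each column. The two triangles of a unit
  -- square make the error on horizontal edges independent of the height, and it vanishes on the
  -- axis.
  obtain ⟨f, -, hf⟩ := exists_int_antiderivative fun x => g (x, 0) (x + 1, 0)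
  choose G hG0 hG using fun x : ℤ => exists_int_antiderivative fun y => g (x, y) (x, y + 1)
  let h : ℤ × ℤ → ℤ := fun p => f p.1 + G p.1 p.2
  have adjx : ∀ x y : ℤ, toomGraph.Adj (x, y) (x + 1, y) := fun x y => by
    rw [toomGraph_adj_iff]; omega
  have adjy : ∀ x y : ℤ, toomGraph.Adj (x, y) (x, y + 1) := fun x y => by
    rw [toomGraph_adj_iff]; omega
  have adjd : ∀ x y : ℤ, toomGraph.Adj (x + 1, y) (x, y + 1) := fun x y => by
    rw [toomGraph_adj_iff]; omega
  have hy : ∀ x y, h (x, y + 1) = h (x, y) + g (x, y) (x, y + 1) := by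
    intro x y
    simp only [h, hG]
    ring
  have square : ∀ x y : ℤ, g (x, y) (x, y + 1) + g (x, y + 1) (x + 1, y + 1) =
      g (x, y) (x + 1, y) + g (x + 1, y) (x + 1, y + 1) := by
    intro x y
    have e1 := hcl _ _ _ (adjx x y) (adjd x y) (adjy x y)
    have e2 := hcl _ _ _ (adjd x y) (adjx x (y + 1)) (adjy (x + 1) y)
    linarith
  have hx : ∀ x y, h (x + 1, y) = h (x, y) + g (x, y) (x + 1, y) := by
    intro x y
    have step : ∀ y, h (x + 1, y + 1) - h (x, y + 1) - g (x, y + 1) (x + 1, y + 1) =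
        h (x + 1, y) - h (x, y) - g (x, y) (x + 1, y) := by
      intro y
      have := square x y
      rw [hy, hy]
      linarith
    suffices hzero : h (x + 1, y) - h (x, y) - g (x, y) (x + 1, y) = 0 by linarith
    induction y using Int.induction_on with
    | zero =>
      simp only [h, hG0, hf]
      ring
    | succ i ih => rw [step, ih]
    | pred i ih =>
      have := step (-(i : ℤ) - 1)
      rw [sub_add_cancel] at this
      rw [← this, ih]
  have hd : ∀ x y, h (x, y + 1) = h (x + 1, y) + g (x + 1, y) (x, y + 1) := by
    intro x y
    have := hcl _ _ _ (adjx x y) (adjd x y) (adjy x y)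
    rw [hx, hy]
    linarith
  have flip : ∀ p q, h q = h p + g p q → h p = h q + g q p := by
    intro p q hpq
    rw [hanti p q]
    linarith
  refine ⟨h, ?_⟩
  rintro ⟨a, b⟩ ⟨c, d⟩ hadj
  rw [toomGraph_adj_iff] at hadj
  rcases hadj with ⟨rfl, rfl⟩ | ⟨rfl, hb⟩ | ⟨rfl, rfl⟩ | ⟨ha, rfl⟩ | ⟨ha, rfl⟩ | ⟨rfl, hb⟩
  · exact hy _ _
  · obtain rfl : b = d + 1 := by omega
    exact flip _ _ (hy _ _)
  · exact hx _ _
  · obtain rfl : a = c + 1 := by omega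
    exact flip _ _ (hx _ _)
  · obtain rfl : a = c + 1 := by omega
    exact hd _ _
  · obtain rfl : b = d + 1 := by omega
    exact flip _ _ (hd _ _)

/-- The complement of a triangle is connected. -/
theorem Triangle.exists_const_compl (I : Triangle) (h : ℤ × ℤ → ℤ)
    (hh : ∀ p q, p ∉ I.points → q ∉ I.points → toomGraph.Adj p q → h p = h q) :
    ∃ m, ∀ p, p ∉ I.points → h p = m := by
  obtain ⟨α, hα⟩ : ∃ α : ℤ, ∀ x : ℤ, -(x : ℝ) ≤ I.a ↔ α ≤ x :=
    ⟨⌈-I.a⌉, fun x => by rw [Int.ceil_le]; constructor <;> intro h <;> linarith⟩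
  obtain ⟨β, hβ⟩ : ∃ β : ℤ, ∀ y : ℤ, -(y : ℝ) ≤ I.b ↔ β ≤ y :=
    ⟨⌈-I.b⌉, fun x => by rw [Int.ceil_le]; constructor <;> intro h <;> linarith⟩
  obtain ⟨γ, hγ⟩ : ∃ γ : ℤ, ∀ x y : ℤ, (x : ℝ) + y ≤ I.c ↔ x + y ≤ γ :=
    ⟨⌊I.c⌋, fun x y => by rw [Int.le_floor]; push_cast; rfl⟩
  have hmem : ∀ x y : ℤ, (x, y) ∈ I.points ↔ α ≤ x ∧ β ≤ y ∧ x + y ≤ γ := fun x y => by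
    rw [Triangle.mem_points_iff, hα, hβ, hγ]
  have step : ∀ a b c d : ℤ, ¬ (α ≤ a ∧ β ≤ b ∧ a + b ≤ γ) → ¬ (α ≤ c ∧ β ≤ d ∧ c + d ≤ γ) →
      toomGraph.Adj (a, b) (c, d) → h (a, b) = h (c, d) := fun a b c d h1 h2 =>
    hh _ _ (by rwa [hmem]) (by rwa [hmem])
  have ray : ∀ a b c d : ℤ, toomGraph.Adj (a, b) (a + c, b + d) →
      (∀ n : ℕ, ¬ (α ≤ a + n * c ∧ β ≤ b + n * d ∧ a + n * c + (b + n * d) ≤ γ)) →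
      ∀ n : ℕ, h (a + n * c, b + n * d) = h (a, b) := by
    intro a b c d hadj hout n
    induction n with
    | zero => simp
    | succ n ih =>
      rw [← ih]
      refine (step _ _ _ _ (hout n) (hout (n + 1)) ?_).symm
      rw [toomGraph_adj_iff] at hadj ⊢
      push_cast
      rw [add_mul, add_mul]
      omega
  have west : ∀ a b : ℤ, a < α → ∀ y : ℤ, h (a, b) = h (a, y) := by
    intro a b ha y
    have main : ∀ b y : ℤ, b ≤ y → h (a, y) = h (a, b) := by
      intro b y hby
      obtain ⟨n, hn⟩ := Int.eq_ofNat_of_zero_le (sub_nonneg.2 hby)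
      have := ray a b 0 1 (by rw [toomGraph_adj_iff]; omega) (fun n => by simp; omega) n
      rw [show b + (n : ℤ) * 1 = y by omega, show a + (n : ℤ) * 0 = a by simp] at this
      exact this
    rcases le_total b y with hby | hby
    · exact (main b y hby).symm
    · exact main y b hby
  have south : ∀ a b : ℤ, b < β → ∀ x : ℤ, h (a, b) = h (x, b) := by
    intro a b hb x
    have main : ∀ a x : ℤ, a ≤ x → h (x, b) = h (a, b) := by
      intro a x hax
      obtain ⟨n, hn⟩ := Int.eq_ofNat_of_zero_le (sub_nonneg.2 hax)
      have := ray a b 1 0 (by rw [toomGraph_adj_iff]; omega) (fun n => by simp; omega) n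
      rw [show a + (n : ℤ) * 1 = x by omega, show b + (n : ℤ) * 0 = b by simp] at this
      exact this
    rcases le_total a x with hax | hax
    · exact (main a x hax).symm
    · exact main x a hax
  have diag : ∀ a b : ℤ, γ < a + b → ∀ n : ℕ, h (a - n, b + n) = h (a, b) := by
    intro a b hab n
    have := ray a b (-1) 1 (by rw [toomGraph_adj_iff]; omega) (fun n => by omega) n
    rw [show a + (n : ℤ) * (-1) = a - n by ring, show b + (n : ℤ) * 1 = b + n by ring] at this
    exact this
  have hsw : ∀ x y x' y' : ℤ, x < α → x' < α → h (x, y) = h (x', y') := by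
    intro x y x' y' hx hx'
    rw [west x y hx (β - 1), south x (β - 1) (by omega) x', west x' y' hx' (β - 1)]
  refine ⟨h (α - 1, β - 1), ?_⟩
  rintro ⟨x, y⟩ hxy
  rw [hmem] at hxy
  by_cases hx : x < α
  · exact hsw _ _ _ _ hx (by omega)
  by_cases hy : y < β
  · rw [south x y hy (α - 1)]
    exact hsw _ _ _ _ (by omega) (by omega)
  · rw [← diag x y (by omega) (x - (α - 1)).toNat]
    exact hsw _ _ _ _ (by omega) (by omega)

/-! ### Cuts surrounded by the set -/

/-- If all neighbours of a cut lie in the set, then one of the two sides is enclosed by the cut. -/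
theorem IsSplit.bigSpan_le_of_surrounded {S : Set (ℤ × ℤ)} {C : Finset (ℤ × ℤ)}
    {A B : Set (ℤ × ℤ)} (h : IsSplit S C A B) (hC : C.Nonempty)
    (hnbr : ∀ p ∈ C, ∀ q, toomGraph.Adj p q → q ∈ S)
    (hA : Indecomposable (A ∪ ↑C : Set (ℤ × ℤ))) (hB : Indecomposable (B ∪ ↑C : Set (ℤ × ℤ))) :
    bigSpan (A ∪ ↑C) ≤ ((6 * (C.card : ℝ) : ℝ) : EReal) ∨
      bigSpan (B ∪ ↑C) ≤ ((6 * (C.card : ℝ) : ℝ) : EReal) := by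
  classical
  obtain ⟨c₀, hc₀⟩ := hC
  obtain ⟨P, hP⟩ := exists_indecomposable_parts C
  let χ : Set (ℤ × ℤ) → ℤ × ℤ → ℤ := fun X p => if p ∈ X then 1 else 0
  have χ1 : ∀ {X : Set (ℤ × ℤ)} {p}, p ∈ X → χ X p = 1 := fun hp => if_pos hp
  have χ0 : ∀ {X : Set (ℤ × ℤ)} {p}, p ∉ X → χ X p = 0 := fun hp => if_neg hp
  -- This counts signed crossings from `K` into `A`. It is closed: a lattice triangle with a vertex
  -- in `K` has its other vertices in `K`, `A` or `B`, never in both `A` and `B`. Its potential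
  -- detects which side `K` encloses.
  let g : Finset (ℤ × ℤ) → ℤ × ℤ → ℤ × ℤ → ℤ := fun K p q => χ K p * χ A q - χ K q * χ A p
  have hKC : ∀ K ∈ P.parts, ∀ p ∈ K, p ∈ C := fun K hK p hp => P.le hK hp
  have hKA : ∀ K ∈ P.parts, ∀ p ∈ A, p ∉ K :=
    fun K hK p hp hpK => h.notMem_C_of_left p hp (hKC K hK p hpK)
  have hpot : ∀ K ∈ P.parts, ∃ f : ℤ × ℤ → ℤ, (∀ p q, toomGraph.Adj p q → f q = f p + g K p q) ∧
      f c₀ = 0 := by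
    intro K hK
    have key : ∀ p q r, toomGraph.Adj p q → toomGraph.Adj q r → toomGraph.Adj p r → p ∈ K →
        g K p q + g K q r = g K p r := by
      intro p q r hpq hqr hpr hp
      have type : ∀ x, toomGraph.Adj p x → (χ K x = 1 ∧ χ A x = 0) ∨ (χ K x = 0 ∧ x ∈ A) ∨
          (χ K x = 0 ∧ χ A x = 0 ∧ x ∈ B) := by
        intro x hpx
        rcases (h.mem_iff x).1 (hnbr p (hKC K hK p hp) x hpx) with hx | hx | hx
        · exact Or.inr (Or.inl ⟨χ0 (hKA K hK x hx), hx⟩)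
        · exact Or.inr (Or.inr ⟨χ0 fun hxK => h.notMem_C_of_right x hx (hKC K hK x hxK),
            χ0 fun hxA => h.notMem_right_of_left x hxA hx, hx⟩)
        · exact Or.inl ⟨χ1 ((hP K hK).2 p hp x hx hpx),
            χ0 fun hxA => h.notMem_C_of_left x hxA hx⟩
      have hpK : χ K p = 1 := χ1 hp
      have hpA : χ A p = 0 := χ0 fun hpA => hKA K hK p hpA hp
      simp only [g, hpK, hpA]
      rcases type q hpq with ⟨a, b⟩ | ⟨a, b⟩ | ⟨a, b, b'⟩ <;>
        rcases type r hpr with ⟨c, d⟩ | ⟨c, d⟩ | ⟨c, d, d'⟩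
      · simp [a, b, c, d]
      · simp [a, b, c, χ1 d]
      · simp [a, b, c, d]
      · simp [a, χ1 b, c, d]
      · simp [a, χ1 b, c, χ1 d]
      · exact absurd hqr (h.not_adj q b r d')
      · simp [a, b, c, d]
      · exact absurd hqr.symm (h.not_adj r d q b')
      · simp [a, b, c, d]
    have anti : ∀ p q, g K q p = -g K p q := fun p q => by simp only [g]; ring
    obtain ⟨f, hf⟩ := exists_potential (g K) anti (by
      intro p q r hpq hqr hpr
      by_cases hp : p ∈ K
      · exact key p q r hpq hqr hpr hp
      by_cases hq : q ∈ K
      · have := key q p r hpq.symm hpr hqr hq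
        rw [anti p q] at this
        linarith
      by_cases hr : r ∈ K
      · have := key r p q hpr.symm hpq hqr.symm hr
        rw [anti p r, anti q r] at this
        linarith
      · have hp' : χ K p = 0 := χ0 hp
        have hq' : χ K q = 0 := χ0 hq
        have hr' : χ K r = 0 := χ0 hr
        simp [g, hp', hq', hr'])
    refine ⟨fun p => f p - f c₀, fun p q hpq => ?_, sub_self _⟩
    simp only [hf p q hpq]
    ring
  choose! f hf hf0 using hpot
  have htri : ∀ K ∈ P.parts, ∃ J : Triangle, 0 ≤ J.span ∧ J.span + 1 ≤ K.card ∧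
      (K : Set (ℤ × ℤ)) ⊆ J.points := fun K hK =>
    exists_triangle_of_finset (hP K hK).1 (P.nonempty_of_mem_parts hK)
  have : Nonempty Triangle := ⟨⟨0, 0, 0⟩⟩
  choose! J hJ0 hJcard hKJ using htri
  -- No edge outside the triangle `J K` touches `K`, and the complement of a triangle is connected.
  have hfar : ∀ K ∈ P.parts, ∃ m, ∀ p, p ∉ (J K).points → f K p = m := by
    intro K hK
    refine (J K).exists_const_compl (f K) fun p q hp hq hpq => ?_
    have hp' : χ K p = 0 := χ0 fun h' => hp (hKJ K hK h')
    have hq' : χ K q = 0 := χ0 fun h' => hq (hKJ K hK h')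
    rw [hf K hK p q hpq]
    simp [g, hp', hq']
  have hfB : ∀ K ∈ P.parts, ∀ p ∈ B ∪ (C : Set (ℤ × ℤ)), f K p = 0 := by
    intro K hK p hp
    rw [← hf0 K hK]
    refine hB.eqOn_const ?_ hp (Or.inr hc₀)
    have hnA : ∀ x ∈ B ∪ (C : Set (ℤ × ℤ)), χ A x = 0 := by
      rintro x (hx | hx)
      · exact χ0 fun hxA => h.notMem_right_of_left x hxA hx
      · exact χ0 fun hxA => h.notMem_C_of_left x hxA hx
    intro x hx y hy hxy
    rw [hf K hK x y hxy]
    simp [g, hnA x hx, hnA y hy]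
  have hsumχ : ∀ p, ∑ K ∈ P.parts, χ K p = χ C p := by
    intro p
    by_cases hp : p ∈ C
    · obtain ⟨K, hK, hpK⟩ := P.exists_mem hp
      rw [Finset.sum_eq_single_of_mem K hK, χ1 (X := (K : Set (ℤ × ℤ))) hpK,
        χ1 (X := (C : Set (ℤ × ℤ))) hp]
      intro L hL hne
      exact χ0 fun hpL => hne (P.eq_of_mem_parts hL hK hpL hpK)
    · rw [χ0 (X := (C : Set (ℤ × ℤ))) hp]
      exact Finset.sum_eq_zero fun K hK => χ0 fun hpK => hp (hKC K hK p hpK)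
  -- Along edges of the connected set `A ∪ C` the summed potential changes exactly as the indicator
  -- of `A`, and both vanish at `c₀`.
  have hfA : ∀ p ∈ A, ∑ K ∈ P.parts, f K p = 1 := by
    intro p hp
    have hconst := hA.eqOn_const (f := fun x => ∑ K ∈ P.parts, f K x - χ A x) ?_
      (p := p) (q := c₀) (Or.inl hp) (Or.inr hc₀)
    · have h0 : χ A c₀ = 0 := χ0 fun hcA => h.notMem_C_of_left c₀ hcA hc₀
      have h1 : ∑ K ∈ P.parts, f K c₀ = 0 := Finset.sum_eq_zero hf0
      have h2 : χ A p = 1 := χ1 hp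
      simp only [h0, h1, h2] at hconst
      linarith
    · have type : ∀ x ∈ A ∪ (C : Set (ℤ × ℤ)), χ C x = 1 - χ A x := by
        rintro x (hx | hx)
        · rw [χ1 hx, χ0 (X := (C : Set (ℤ × ℤ))) (h.notMem_C_of_left x hx), sub_self]
        · rw [χ1 hx, χ0 (X := A) fun hxA => h.notMem_C_of_left x hxA hx, sub_zero]
      intro x hx y hy hxy
      have : ∑ K ∈ P.parts, f K y = ∑ K ∈ P.parts, f K x + (χ C x * χ A y - χ C y * χ A x) := by
        rw [← hsumχ x, ← hsumχ y, Finset.sum_mul, Finset.sum_mul, ← Finset.sum_sub_distrib,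
          ← Finset.sum_add_distrib]
        exact Finset.sum_congr rfl fun K hK => hf K hK x y hxy
      simp only [this, type x hx, type y hy]
      ring
  have hcardP : ∑ K ∈ P.parts, (K.card : ℝ) = C.card := by exact_mod_cast P.sum_card_parts
  have hKpos : ∀ K ∈ P.parts, (1 : ℝ) ≤ K.card := fun K hK => by
    exact_mod_cast (P.nonempty_of_mem_parts hK).card_pos
  -- If all potentials vanish far away, each point of `A` has a nonzero one and so lies in some `J
  -- K`; inflation costs `(|K| - 1) + 6 ≤ 6 |K|` per part. Otherwise one potential is a nonzero
  -- constant outside `J K` but zero on `B ∪ C`, which is therefore inside `J K`.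
  by_cases hm : ∀ K ∈ P.parts, ∀ p, p ∉ (J K).points → f K p = 0
  · left
    let infl : Finset (ℤ × ℤ) → Triangle := fun K => ⟨(J K).a + 2, (J K).b + 2, (J K).c + 2⟩
    have hinfl : ∀ K, (infl K).span = (J K).span + 6 := fun K => by
      simp only [infl, Triangle.span]; ring
    refine bigSpan_le_of_cover (𝓘 := P.parts.image infl) ⟨?_, ?_⟩ ?_
    · intro I hI
      obtain ⟨K, hK, rfl⟩ := Finset.mem_image.1 hI
      rw [hinfl]
      linarith [hJ0 K hK]
    · have hcov : ∀ p ∈ A ∪ (C : Set (ℤ × ℤ)), ∃ K ∈ P.parts, p ∈ (J K).points := by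
        rintro p (hp | hp)
        · by_contra hcon
          push Not at hcon
          have := hfA p hp
          rw [Finset.sum_eq_zero fun K hK => hm K hK p (hcon K hK)] at this
          exact zero_ne_one this
        · obtain ⟨K, hK, hpK⟩ := P.exists_mem hp
          exact ⟨K, hK, hKJ K hK hpK⟩
      intro p hp
      obtain ⟨K, hK, hpK⟩ := hcov p hp
      refine Set.mem_iUnion₂.2 ⟨infl K, Finset.mem_image_of_mem _ hK, ?_⟩
      simpa [infl, Triangle.deflate] using hpK
    · calc ∑ I ∈ P.parts.image infl, I.span ≤ ∑ K ∈ P.parts, (infl K).span := by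
            refine Finset.sum_image_le_of_nonneg fun I hI => ?_
            obtain ⟨K, hK, rfl⟩ := Finset.mem_image.1 hI
            rw [hinfl]
            linarith [hJ0 K hK]
        _ ≤ ∑ K ∈ P.parts, 6 * (K.card : ℝ) := Finset.sum_le_sum fun K hK => by
            rw [hinfl]
            linarith [hJcard K hK, hKpos K hK]
        _ = 6 * C.card := by rw [← Finset.mul_sum, hcardP]
  · right
    push Not at hm
    obtain ⟨K, hK, x, hx, hx0⟩ := hm
    obtain ⟨m, hm⟩ := hfar K hK
    have hsub : B ∪ (C : Set (ℤ × ℤ)) ⊆ (J K).points := by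
      intro p hp
      by_contra hpJ
      exact hx0 (by rw [hm x hx, ← hm p hpJ, hfB K hK p hp])
    refine (bigSpan_le_of_subset_points (hJ0 K hK) hsub).trans (EReal.coe_le_coe_iff.2 ?_)
    have hle : (K.card : ℝ) ≤ C.card := by exact_mod_cast Finset.card_le_card (P.le hK)
    linarith [hJcard K hK, hKpos K hK]

/-! ### The thickness of the image under the biased rule -/

theorem exists_smaller_hasWideSplit {S : Set (ℤ × ℤ)} (hS : Indecomposable S) {k : ℕ}
    (hk : HasWideSplit (biasedToom S) k) (hmin : ∀ m < k, ¬ HasWideSplit (biasedToom S) m) :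
    ∃ m < k, HasWideSplit S m := by
  obtain ⟨C, A, B, h, rfl, hA, hB⟩ := hk
  have hS' : Indecomposable (biasedToom S) := hS.toom.toom.inflate
  have hEA := h.indecomposable_left hS' hA hB hmin
  have hEB := h.swap.indecomposable_left hS' hB hA hmin
  -- With an empty cut, connectedness would leave one side empty, of span at most 0.
  have hC : C.Nonempty := by
    rw [Finset.nonempty_iff_ne_empty]
    rintro rfl
    have hne : ∀ X : Set (ℤ × ℤ), ((6 * ((∅ : Finset (ℤ × ℤ)).card : ℝ) : ℝ) : EReal) <
        bigSpan (X ∪ ↑(∅ : Finset (ℤ × ℤ))) → X.Nonempty := by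
      intro X hX
      rw [Set.nonempty_iff_ne_empty]
      rintro rfl
      simp only [Finset.card_empty, Nat.cast_zero, mul_zero, Finset.coe_empty,
        Set.union_empty] at hX
      exact absurd hX (not_lt.2 bigSpan_empty_le)
    obtain ⟨b, hb⟩ := hne B hB
    refine h.notMem_right_of_left b (hS' A (fun p hp => (h.mem_iff p).2 (Or.inl hp)) (hne A hA)
      ?_ ((h.mem_iff b).2 (Or.inr (Or.inl hb)))) hb
    intro p hp q hq hpq
    rcases (h.mem_iff q).1 hq with hq | hq | hq
    · exact hq
    · exact absurd hpq (h.not_adj p hp q hq)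
    · exact absurd hq (Finset.notMem_empty q)
  by_cases hin : ∀ p ∈ C, ∀ r, p ∈ tile r → r ∈ toom (toom S)
  · refine absurd (h.bigSpan_le_of_surrounded hC ?_ hEA hEB) ?_
    · intro p hp q hpq
      obtain ⟨r, hpr, hqr⟩ := exists_tile_of_adj hpq
      exact mem_inflate_iff.2 ⟨r, hin p hp r hpr, hqr⟩
    · rw [not_or, not_le, not_le]
      exact ⟨hA, hB⟩
  · push Not at hin
    obtain ⟨p, hp, r, hpr, hr⟩ := hin
    obtain ⟨C₁, F, A₁, B₁, h₁, hcard, hF, hA₁, hB₁⟩ := IsSplit.exists_shift h hp hpr hr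
    obtain ⟨C₂, A₂, B₂, h₂, hcard₂, hA₂, hB₂⟩ := h₁.exists_lift
    obtain ⟨C₃, A₃, B₃, h₃, hcard₃, hA₃, hB₃⟩ := h₂.exists_lift
    have hFpos := hF.card_pos
    have wide : ∀ D D₁ D₂ D₃ : Set (ℤ × ℤ), Indecomposable (D ∪ ↑C : Set (ℤ × ℤ)) →
        ((6 * (C.card : ℝ) : ℝ) : EReal) < bigSpan (D ∪ ↑C) →
        (∀ q ∈ D ∪ (C : Set (ℤ × ℤ)), q ∈ F ∨ ∃ u ∈ D₁ ∪ (C₁ : Set (ℤ × ℤ)), q ∈ tile u) →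
        (∀ u ∈ D₁ ∪ (C₁ : Set (ℤ × ℤ)), ∃ w ∈ D₂ ∪ (C₂ : Set (ℤ × ℤ)), w ∈ tile u) →
        (∀ w ∈ D₂ ∪ (C₂ : Set (ℤ × ℤ)), ∃ x ∈ D₃ ∪ (C₃ : Set (ℤ × ℤ)), x ∈ tile w) →
        ((6 * (C₃.card : ℝ) : ℝ) : EReal) < bigSpan (D₃ ∪ ↑C₃) := by
      intro D D₁ D₂ D₃ hD hspan hD₁ hD₂ hD₃
      by_contra hcon
      rw [not_lt] at hcon
      refine absurd hspan (not_lt.2 ((bigSpan_le_of_near (F := F) hD ⟨p, Or.inr hp⟩ hcon ?_).trans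
        (EReal.coe_le_coe_iff.2 ?_)))
      · intro q hq
        rcases hD₁ q hq with hqF | ⟨u, hu, hqu⟩
        · exact Or.inl hqF
        · obtain ⟨w, hw, hwu⟩ := hD₂ u hu
          obtain ⟨x, hx, hxw⟩ := hD₃ w hw
          exact Or.inr ⟨u, w, x, hqu, hwu, hxw, hx⟩
      -- Since `|C₃| ≤ |C| - |F|`, this reduces to `5 ≤ 5 |F|`: the factor 6 leaves just enough for
      -- one lost cut point.
      · have : 6 * C₃.card + F.card + 5 ≤ 6 * C.card := by omega
        exact_mod_cast this
    exact ⟨C₃.card, by omega, C₃, A₃, B₃, h₃, rfl, wide A A₁ A₂ A₃ hEA hA hA₁ hA₂ hA₃,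
      wide B B₁ B₂ B₃ hEB hB hB₁ hB₂ hB₃⟩

theorem theorem3 (S : Set (ℤ × ℤ)) (hS : IsConn S) :
    thickness S 6 + 1 ≤ thickness (biasedToom S) 6 := by
  by_cases htop : thickness (biasedToom S) 6 = ⊤
  · rw [htop]
    exact le_top
  · obtain ⟨k, hk, hsplit⟩ := exists_hasWideSplit_of_thickness_ne_top htop
    obtain ⟨m, hmk, hm⟩ := exists_smaller_hasWideSplit hS.indecomposable hsplit
      fun m hmk hm => absurd (hm.thickness_le) (by rw [hk, not_le]; exact_mod_cast hmk)
    rw [hk]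
    calc thickness S 6 + 1 ≤ (m : ℕ∞) + 1 := by gcongr; exact hm.thickness_le
      _ ≤ k := by exact_mod_cast hmk
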